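/- **Programs.** Consider programs with a symbolic positive integer parameter $N$, built from assignments to integer scalars $v:=E$ and to array cells $A[E]:=E$, sequencing, conditionals, and loops $\mathbf{for}(\ell:=0;\ \ell<U;\ \ell:=\ell+1)\{\dots\}$. Here $\ell$ is a loop counter that the body does not update, and the bound $U$ is an arithmetic expression in $N$, constants and the counters of the enclosing loops. $\mathsf P_N$ is the instance of the program $\mathsf P$ at the value $N$. A triple $\{\alpha\}\,\mathsf S\,\{\beta\}$ holds if $\mathsf S$, run from any state satisfying $\alpha$, ends in a state satisfying $\beta$ (all these programs terminate). Two programs are semantically equivalent if from each state they compute the same values of all arrays and of all scalars other than loop counters. **Setting.** Let $\mathsf P_N$ be a program, let $\varphi(N)$ be a pre-condition, and let $\psi(N)$ be a post-condition. For every $N>1$ let the following be given. - Programs $\mathsf Q_{N-1}$ (the version of $\mathsf P_N$ with its loops cut down to the bounds for $N-1$) and $\mathsf{peel}(\mathsf P_N)$ such that $\mathsf P_N$ is semantically equivalent to $\mathsf Q_{N-1};\mathsf{peel}(\mathsf P_N)$. - Formulas $\varphi'(N-1)$ and $\Delta\varphi'(N)$ such that $\varphi(N)\Rightarrow\varphi'(N-1)\wedge\Delta\varphi'(N)$,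 and such that no variable or array cell on which $\Delta\varphi'(N)$ depends is modified by $\mathsf Q_{N-1}$ when started in a state satisfying $\varphi'(N-1)$. - A difference invariant $D(V_{\mathsf Q},V_{\mathsf P},N-1)$, where $V_{\mathsf Q}$ and $V_{\mathsf P}$ are disjoint copies of the variables for $\mathsf Q_{N-1}$ and $\mathsf P_{N-1}$. It holds at the end of every joint execution of $\mathsf Q_{N-1}$, started in a state satisfying $\varphi'(N-1)$, and $\mathsf P_{N-1}$, started in a state satisfying $\varphi(N-1)$, whose two initial states are related by a given relation $\mathit{Init}(V_{\mathsf Q},V_{\mathsf P},N-1)$. The formulas $\psi$ and $\xi$ (below) do not depend on loop counters. **Theorem.** Suppose there are formulas $\xi(N)$, $\xi'(N)$ and an integer $M>0$ such that for each $N>M$ every state satisfying $\varphi'(N-1)$ is related by $\mathit{Init}(V_{\mathsf Q},V_{\mathsf P},N-1)$ to at least one state satisfying $\varphi(N-1)$, and such that 1. $\{\varphi(N)\}\ \mathsf P_N\ \{\psi(N)\wedge\xi(N)\}$ holds for $1\le N\le M$; 2. $\xi(N)\wedge D(V_{\mathsf Q},V_{\mathsf P},N)\Rightarrow\xi'(N)$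 for all $N>0$, where $\xi(N)$ speaks about $V_{\mathsf P}$ and $\xi'(N)$ about $V_{\mathsf Q}$; 3. $\{\xi'(N-1)\wedge\Delta\varphi'(N)\wedge\psi'(N-1)\}\ \mathsf{peel}(\mathsf P_N)\ \{\xi(N)\wedge\psi(N)\}$ holds for all $N\ge M$, where $\psi'(N-1)\equiv\exists V_{\mathsf P}\,\big(\psi(N-1)\wedge D(V_{\mathsf Q},V_{\mathsf P},N-1)\big)$. Then $\{\varphi(N)\}\ \mathsf P_N\ \{\psi(N)\}$ holds for all $N>0$. -/

import Mathlib

/-! Programs over scalars, loop counters and integer arrays, with a symbolic parameter `N`.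
`V` : names of the scalars that are not loop counters, `L` : names of the loop counters,
`A` : names of the arrays. -/

/-- The arithmetic operators `+`, `-`, `*`, `/`. -/
inductive ArithOp where
  | add | sub | mul | div

/-- Integer arithmetic; `/` truncates towards zero, as in C, and is made total by `x / 0 = 0`. -/
def ArithOp.eval : ArithOp → ℤ → ℤ → ℤ
  | .add, a, b => a + b
  | .sub, a, b => a - b
  | .mul, a, b => a * b
  | .div, a, b => a.tdiv b

/-- The comparison operators. -/
inductive RelOp where
  | lt | le | eq | ne | ge | gt

def RelOp.Holds : RelOp → ℤ → ℤ → Prop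
  | .lt, a, b => a < b
  | .le, a, b => a ≤ b
  | .eq, a, b => a = b
  | .ne, a, b => a ≠ b
  | .ge, a, b => a ≥ b
  | .gt, a, b => a > b

/-- Expressions `E ::= E op E | A[E] | v | ℓ | c | N`. -/
inductive Expr (V L A : Type) where
  | bin (op : ArithOp) (e₁ e₂ : Expr V L A)
  | read (a : A) (idx : Expr V L A)
  | var (v : V)
  | ctr (l : L)
  | const (c : ℤ)
  | param

/-- Upper bounds of loops `UB ::= UB op UB | ℓ | c | N`. -/
inductive UBound (L : Type) where
  | bin (op : ArithOp) (u₁ u₂ : UBound L)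
  | ctr (l : L)
  | const (c : ℤ)
  | param

/-- Conditions `BoolE ::= E relop E | BoolE AND BoolE | NOT BoolE | BoolE OR BoolE`. -/
inductive BoolExpr (V L A : Type) where
  | rel (r : RelOp) (e₁ e₂ : Expr V L A)
  | and (b₁ b₂ : BoolExpr V L A)
  | not (b : BoolExpr V L A)
  | or (b₁ b₂ : BoolExpr V L A)

/-- Statements; `skip` is the empty program, and `loop ℓ U S` is
`for (ℓ := 0; ℓ < U; ℓ := ℓ + 1) {S}`. -/
inductive Stmt (V L A : Type) where
  | skip
  | seq (s₁ s₂ : Stmt V L A)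
  | assign (v : V) (e : Expr V L A)
  | write (a : A) (idx e : Expr V L A)
  | ite (b : BoolExpr V L A) (s₁ s₂ : Stmt V L A)
  | loop (l : L) (ub : UBound L) (body : Stmt V L A)

/-- The loop counters that occur in an upper bound. -/
def UBound.counters {L : Type} : UBound L → Set L
  | .bin _ u₁ u₂ => u₁.counters ∪ u₂.counters
  | .ctr l => {l}
  | .const _ => ∅
  | .param => ∅

/-- Well-formedness inside loops whose counters form the set `encl`: a loop does not reuse the
counter of a loop around it, and its upper bound mentions only counters of loops around it. -/
def Stmt.WellFormed {V L A : Type} : Set L → Stmt V L A → Prop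
  | _, .skip => True
  | encl, .seq s₁ s₂ => s₁.WellFormed encl ∧ s₂.WellFormed encl
  | _, .assign _ _ => True
  | _, .write _ _ _ => True
  | encl, .ite _ s₁ s₂ => s₁.WellFormed encl ∧ s₂.WellFormed encl
  | encl, .loop l ub body =>
      l ∉ encl ∧ ub.counters ⊆ encl ∧ body.WellFormed (insert l encl)

/-- A program with symbolic parameter `N`. One such object stands for the whole family of
its instances, one for each value of `N`. -/
structure Program (V L A : Type) where
  body : Stmt V L A
  wellFormed : body.WellFormed ∅

/-- Storage locations: scalars, loop counters, and the cells of arrays. -/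
inductive Loc (V L A : Type) where
  | var (v : V)
  | ctr (l : L)
  | elem (a : A) (i : ℤ)

/-- A state assigns an integer to every location. -/
abbrev State (V L A : Type) := Loc V L A → ℤ

def Expr.eval {V L A : Type} (N : ℕ) (s : State V L A) : Expr V L A → ℤ
  | .bin op e₁ e₂ => op.eval (e₁.eval N s) (e₂.eval N s)
  | .read a idx => s (.elem a (idx.eval N s))
  | .var v => s (.var v)
  | .ctr l => s (.ctr l)
  | .const c => c
  | .param => N

def UBound.eval {V L A : Type} (N : ℕ) (s : State V L A) : UBound L → ℤ
  | .bin op u₁ u₂ => op.eval (u₁.eval N s) (u₂.eval N s)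
  | .ctr l => s (.ctr l)
  | .const c => c
  | .param => N

def BoolExpr.Holds {V L A : Type} (N : ℕ) (s : State V L A) : BoolExpr V L A → Prop
  | .rel r e₁ e₂ => r.Holds (e₁.eval N s) (e₂.eval N s)
  | .and b₁ b₂ => b₁.Holds N s ∧ b₂.Holds N s
  | .not b => ¬ b.Holds N s
  | .or b₁ b₂ => b₁.Holds N s ∨ b₂.Holds N s

/-- `iterSteps f k s` applies `f 0`, `f 1`, …, `f (k - 1)` in this order to `s`. -/
def iterSteps {σ : Type} (f : ℕ → σ → σ) : ℕ → σ → σ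
  | 0, s => s
  | k + 1, s => f k (iterSteps f k s)

open Classical in
/-- The final state of a statement, run with parameter value `N`. In a well-formed program the
value of a loop bound cannot change while the loop runs, so it is computed on entry; every
statement terminates. -/
noncomputable def Stmt.exec {V L A : Type} (N : ℕ) : Stmt V L A → State V L A → State V L A
  | .skip, s => s
  | .seq s₁ s₂, s => s₂.exec N (s₁.exec N s)
  | .assign v e, s => Function.update s (.var v) (e.eval N s)
  | .write a idx e, s => Function.update s (.elem a (idx.eval N s)) (e.eval N s)
  | .ite b s₁ s₂, s => if b.Holds N s then s₁.exec N s else s₂.exec N s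
  | .loop l ub body, s =>
      let k : ℕ := (ub.eval N s).toNat
      Function.update
        (iterSteps (fun i t => body.exec N (Function.update t (.ctr l) (i : ℤ))) k s)
        (.ctr l) (k : ℤ)

/-- `P.run N` is the input-output function of the instance of `P` at the value `N`. -/
noncomputable def Program.run {V L A : Type} (P : Program V L A) (N : ℕ) :
    State V L A → State V L A :=
  P.body.exec N

/-- Formulas with the free parameter `N`, by their meaning. -/
abbrev Formula (V L A : Type) := ℕ → State V L A → Prop

/-- Formulas over two disjoint copies of the variables; the first state gives the values of the
variables `V_Q`, the second one those of `V_P`. -/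
abbrev Formula₂ (V L A : Type) := ℕ → State V L A → State V L A → Prop

/-- The Hoare triple `{pre} P_N {post}`. -/
def Triple {V L A : Type} (pre : State V L A → Prop) (P : Program V L A) (N : ℕ)
    (post : State V L A → Prop) : Prop :=
  ∀ s, pre s → post (P.run N s)

/-- The array cells and the scalars that are not loop counters. -/
def observable (V L A : Type) : Set (Loc V L A) := {x | ∀ l, x ≠ .ctr l}

/-- `Q` and `R` split `P` at the parameter value `N`: `P_N` is semantically equivalent to `Q; R`,
that is, from each state both compute the same values of all arrays and of all scalars other
than loop counters. `Q` plays the part of `Q_{N-1}`, the version of `P_N` whose loops are cut down to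
the bounds for `N - 1`, and `R` that of `peel(P_N)`. Both may use `N`. -/
def Splits {V L A : Type} (P Q R : Program V L A) (N : ℕ) : Prop :=
  ∀ s, Set.EqOn (P.run N s) (R.run N (Q.run N s)) (observable V L A)

/-- `φ'(N-1)` and `Δφ'(N)` are a formula difference of `φ(N)` with respect to `Q_{N-1}`: `φ(N)`
implies both, and `Δφ'(N)` speaks only about a set `F` of variables and array cells that
`Q_{N-1}`, started in a state with `φ'(N-1)`, does not modify. -/
structure IsFormulaDiff {V L A : Type} (φ φ' Δφ' : Formula V L A) (Q : Program V L A)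
    (N : ℕ) : Prop where
  implies : ∀ s, φ N s → φ' (N - 1) s ∧ Δφ' N s
  unmodified : ∃ F : Set (Loc V L A), DependsOn (Δφ' N) F ∧
    ∀ s, φ' (N - 1) s → Set.EqOn (Q.run N s) s F

/-- `D(V_Q, V_P, N-1)` is a difference invariant at the end of the joint executions of `Q_{N-1}`,
started in a state with `φ'(N-1)`, and `P_{N-1}`, started in a state with `φ(N-1)`. The two
initial states are tied to each other by the relation `Init(V_Q, V_P, N-1)`. -/
def IsDiffInvariant {V L A : Type} (Init D : Formula₂ V L A) (Q P : Program V L A)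
    (φ' φ : Formula V L A) (N : ℕ) : Prop :=
  ∀ sQ sP, φ' (N - 1) sQ → φ (N - 1) sP → Init (N - 1) sQ sP →
    D (N - 1) (Q.run N sQ) (P.run (N - 1) sP)

/-- Each initial state of `Q_{N-1}` with `φ'(N-1)` occurs in a joint execution. -/
def HasJointExecutions {V L A : Type} (Init : Formula₂ V L A) (φ' φ : Formula V L A)
    (N : ℕ) : Prop :=
  ∀ sQ, φ' (N - 1) sQ → ∃ sP, φ (N - 1) sP ∧ Init (N - 1) sQ sP

/-- `ψ'(N) ≡ ∃ V_P (ψ(N) ∧ D(V_Q, V_P, N))`, a formula over `V_Q`. -/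
def elimVP {V L A : Type} (ψ : Formula V L A) (D : Formula₂ V L A) : Formula V L A :=
  fun N sQ => ∃ sP, ψ N sP ∧ D N sQ sP

/-! Induction on `N` for the stronger post-condition `ψ ∧ ξ`: the triple for the peel needs
`ξ'(N-1)`, which comes from `ξ(N-1)`. Above `M`, a run of `Q_{N-1}` from a state with `φ(N)` is
paired with a run of `P_{N-1}` from an `Init`-related state with `φ(N-1)`. The induction hypothesis
speaks about the end of the second run, and `D` carries its conclusion over to the end of the first
as `ξ'` and `ψ'`. Since `Q_{N-1}` leaves `Δφ'(N)` intact, the pre-condition of the peel holds there.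
-/

/-- A formula that depends only on the locations in `F` is transferred between states that agree
on `F`. -/
theorem DependsOn.of_eqOn {V L A : Type} {p : State V L A → Prop} {F : Set (Loc V L A)}
    (hp : DependsOn p F) {s t : State V L A} (hst : Set.EqOn s t F) (ht : p t) : p s :=
  (hp fun _ hx => hst hx).mpr ht

theorem theorem2 {V L A : Type}
    (P Q R : Program V L A)
    (φ ψ φ' Δφ' ξ ξ' : Formula V L A) (Init D : Formula₂ V L A) (M : ℕ)
    (hψ : ∀ N, DependsOn (ψ N) (observable V L A))
    (hξ : ∀ N, DependsOn (ξ N) (observable V L A))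
    (hsplit : ∀ N, 1 < N → Splits P Q R N)
    (hdiff : ∀ N, 1 < N → IsFormulaDiff φ φ' Δφ' Q N)
    (hD : ∀ N, 1 < N → IsDiffInvariant Init D Q P φ' φ N)
    (hjoint : ∀ N, M < N → HasJointExecutions Init φ' φ N)
    (hM : 0 < M)
    (hbase : ∀ N, 1 ≤ N → N ≤ M → Triple (φ N) P N (fun s => ψ N s ∧ ξ N s))
    (hstrengthen : ∀ N, 0 < N → ∀ sQ sP, ξ N sP ∧ D N sQ sP → ξ' N sQ)
    (hstep : ∀ N, M ≤ N →
      Triple (fun s => ξ' (N - 1) s ∧ Δφ' N s ∧ elimVP ψ D (N - 1) s) R N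
        (fun s => ξ N s ∧ ψ N s)) :
    ∀ N, 0 < N → Triple (φ N) P N (ψ N) := by
  have strengthened : ∀ N, 1 ≤ N → Triple (φ N) P N (fun s => ψ N s ∧ ξ N s) := by
    intro N hN
    induction N, hN using Nat.le_induction with
    | base => exact hbase 1 le_rfl hM
    | succ n hn ih =>
      rcases le_or_gt (n + 1) M with hle | hlt
      · exact hbase (n + 1) (by omega) hle
      · intro s hs
        have hn1 : 1 < n + 1 := by omega
        obtain ⟨hφ', hΔ⟩ := (hdiff (n + 1) hn1).implies s hs
        obtain ⟨F, hF, hkeep⟩ := (hdiff (n + 1) hn1).unmodified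
        -- Without such a companion state the induction hypothesis would say nothing about the run
        -- of `Q`. Here `n + 1 - 1` is `n` by computation, so `ih` applies to `sP`.
        obtain ⟨sP, hsP, hInit⟩ := hjoint (n + 1) hlt s hφ'
        have hDn := hD (n + 1) hn1 s sP hφ' hsP hInit
        obtain ⟨hψn, hξn⟩ := ih sP hsP
        -- The witness for the quantified `V_P` in `ψ'` is the final state of `P_n` run from `sP`.
        obtain ⟨hξR, hψR⟩ := hstep (n + 1) hlt.le (Q.run (n + 1) s)
          ⟨hstrengthen n hn _ _ ⟨hξn, hDn⟩, hF.of_eqOn (hkeep s hφ') hΔ, _, hψn, hDn⟩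
        -- The split may give different final loop counters, so `ψ` and `ξ` return to `P` only
        -- because they ignore counters.
        have heq := hsplit (n + 1) hn1 s
        exact ⟨(hψ (n + 1)).of_eqOn heq hψR, (hξ (n + 1)).of_eqOn heq hξR⟩
  exact fun N hN s hs => (strengthened N hN s hs).1
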